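/- Let $k\ge 2$ and $n=4k$, and let $Q_{4k}=\langle t,u \mid t^{2k}=u^4=1,\ t^k=u^2,\ u^{-1}tu=t^{-1}\rangle$ be the generalized quaternion group of order $n$. Identify $Q_{4k}$ with $\{1,\dots,n\}$ by letting $t^{i}$ correspond to $i+1$ and $t^{i}u$ to $2k+i+1$, for $0\le i\le 2k-1$, and let $H\subseteq \mathrm{Sym}_n$ be the image of the regular representation of $Q_{4k}$ by left multiplication under this identification. Then the monoid $$S_n(H)=\langle a_1,\dots,a_n \mid a_1a_2\cdots a_n=a_{\sigma(1)}a_{\sigma(2)}\cdots a_{\sigma(n)},\ \sigma\in H\rangle$$ is a two unique product semigroup: for any nonempty finite subsets $C,D\subseteq S_n(H)$ with $|C|+|D|>2$, there are at least two elements of $CD=\{cd : c\in C,\ d\in D\}$ that have a unique expression of the form $cd$ with $c\in C$ and $d\in D$. -/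

import Mathlib

/-- The word `x_{σ(1)} x_{σ(2)} ⋯ x_{σ(n)}` in the free monoid on `n` letters
(the letters are indexed by `Fin n`, that is, from `0` instead of from `1`). -/
def permWord {n : ℕ} (σ : Equiv.Perm (Fin n)) : FreeMonoid (Fin n) :=
  FreeMonoid.ofList (List.ofFn fun i => σ i)

/-- The defining relations `x_1 x_2 ⋯ x_n = x_{σ(1)} x_{σ(2)} ⋯ x_{σ(n)}`, for `σ ∈ H`. -/
def permRel {n : ℕ} (H : Subgroup (Equiv.Perm (Fin n))) (v w : FreeMonoid (Fin n)) : Prop :=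
  ∃ σ ∈ H, v = permWord 1 ∧ w = permWord σ

/-- The monoid `S_n(H) = ⟨a_1, …, a_n ∣ a_1 a_2 ⋯ a_n = a_{σ(1)} a_{σ(2)} ⋯ a_{σ(n)}, σ ∈ H⟩`. -/
abbrev PermMonoid {n : ℕ} (H : Subgroup (Equiv.Perm (Fin n))) : Type :=
  PresentedMonoid (permRel H)

namespace QuaternionGroup

/-- The generator `t` of the generalized quaternion group of order `4 * k`, in which
`t ^ (2 * k) = u ^ 4 = 1`, `t ^ k = u ^ 2` and `u⁻¹ * t * u = t⁻¹`. -/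
def t (k : ℕ) : QuaternionGroup k := a 1

/-- The generator `u` of the generalized quaternion group of order `4 * k`. -/
def u (k : ℕ) : QuaternionGroup k := xa 0

/-- The list `1, t, …, t^{2k-1}, u, tu, …, t^{2k-1}u` of the elements of the generalized
quaternion group: position `i < 2k` holds `t^i` and position `2k + i` holds `t^i u`. -/
def enum (k : ℕ) (i : Fin (4 * k)) : QuaternionGroup k :=
  if (i : ℕ) < 2 * k then t k ^ (i : ℕ) else t k ^ ((i : ℕ) - 2 * k) * u k

theorem enum_bijective (k : ℕ) [NeZero k] : Function.Bijective (enum k) := by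
  have hk : 0 < k := Nat.pos_of_ne_zero (NeZero.ne k)
  have hpow : ∀ i : ℕ, t k ^ i = a (i : ZMod (2 * k)) := fun i => a_one_pow i
  rw [Fintype.bijective_iff_injective_and_card]
  refine ⟨fun i j hij => ?_, by simp [card]⟩
  have key : ∀ p q : ℕ, p < 2 * k → q < 2 * k →
      ((p : ZMod (2 * k)) = (q : ZMod (2 * k))) → p = q := fun p q hp hq h =>
    Nat.ModEq.eq_of_lt_of_lt ((ZMod.natCast_eq_natCast_iff p q (2 * k)).1 h) hp hq
  have hi := i.2
  have hj := j.2
  unfold enum at hij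
  ext
  split_ifs at hij with h1 h2 h2
  · rw [hpow, hpow, a.injEq] at hij
    exact key _ _ h1 h2 hij
  · simp [hpow, u] at hij
  · simp [hpow, u] at hij
  · rw [mul_left_inj, hpow, hpow, a.injEq] at hij
    have := key _ _ (by omega) (by omega) hij
    omega

/-- The identification of the generalized quaternion group with the `4k` positions. -/
noncomputable def positions (k : ℕ) [NeZero k] : QuaternionGroup k ≃ Fin (4 * k) :=
  (Equiv.ofBijective (enum k) (enum_bijective k)).symm

/-- The regular (Cayley) representation of the generalized quaternion group by left
multiplications, as permutations of the `4k` positions. -/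
noncomputable def cayleyRep (k : ℕ) [NeZero k] :
    QuaternionGroup k →* Equiv.Perm (Fin (4 * k)) :=
  (positions k).permCongrHom.toMonoidHom.comp
    (MulAction.toPermHom (QuaternionGroup k) (QuaternionGroup k))

end QuaternionGroup

/-!
Write the letters as the elements of the quaternion group `Γ` and let `e 0, …, e (n - 1)` be the
given enumeration of `Γ`. The defining relations say that the words
`w_g = (g * e 0) (g * e 1) ⋯ (g * e (n - 1))`, for `g : Γ`, are all equal. The consecutive quotients
`(e i)⁻¹ * e (i + 1)` are `t, …, t, t * u, t⁻¹, …, t⁻¹`, with `2 * k - 1` copies of `t` and of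
`t⁻¹`. As `k ≥ 2`, a proper suffix of one `w_g` of length at least two is never a prefix of another
one (`RatioProfile.exists_ne_of_overlap`). The whole situation is symmetric under reading words
backwards, so each statement about first letters has a mirror image in the opposite monoid.

Two equal words with different first letters `a ≠ b` are equal to common right multiples of the full
words that begin with `a` and `b` (`WordEq.head`). With the overlap property this makes the
factorizations of an element rigid: if `c * d = c' * d'` with `c ≠ c'` of equal length, then
`c = p P_g`, `d = S_g q`, `c' = p P_h`, `d' = S_h q`, where `w_g = P_g S_g` and `w_h = P_h S_h` are
cut in the same position `i` and `g ≠ h` (`WordSystem.exists_cut`).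

Now let `A` and `B` be finite sets. Considering the elements of extreme length, one may assume that
each of them consists of elements of constant length (`twoUniqueProds_of_homogeneous`). If every
pair is unique there is nothing to do. Otherwise some pair arises from a cut as above, and the
exchanged pairs `(p P_g, S_h q)` and `(p P_h, S_g q)` are the candidates for unique products.

* If `2 ≤ i ≤ n - 2`, both are unique: two letters on each side of the cut determine the quotient
  at the cut, and that forces `g = h` (`WordSystem.not_cut_of_middle`).
* If `i = 1`, the non-uniqueness of `(p P_g, S_h q)` determines the last letter of `p` in terms of
  `g` (`WordSystem.cut_of_cross`). So at least one exchanged pair is unique, and if the other one is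
  not, then the same lemma and its mirror image, applied to a cut through the non-unique pair,
  provide a second unique pair (`WordSystem.hasTwoUnique_of_cross`).
* The case `i = n - 1` is the mirror image of the case `i = 1`.
-/

open MulOpposite Relation

/-! ### Segments of the defining words -/

section Segments
variable {Γ M : Type*} [Group Γ] [Monoid M]

/-- The product of the letters in positions `i, …, j - 1` of the word `w_g`, whose letter in
position `m` is `x (g * e m)`. -/
def seg (x : Γ → M) (e : ℕ → Γ) (g : Γ) (i j : ℕ) : M :=
  ((List.range' i (j - i)).map fun m => x (g * e m)).prod

variable {x : Γ → M} {e : ℕ → Γ} {g h : Γ} {i j n : ℕ}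

theorem seg_self (x : Γ → M) (e : ℕ → Γ) (g : Γ) (i : ℕ) : seg x e g i i = 1 := by simp [seg]

theorem seg_cons (hij : i < j) : seg x e g i j = x (g * e i) * seg x e g (i + 1) j := by
  obtain ⟨d, rfl⟩ := Nat.exists_eq_add_of_lt hij
  have h1 : i + d + 1 - i = d + 1 := by omega
  have h2 : i + d + 1 - (i + 1) = d := by omega
  simp [seg, h1, h2, List.range'_succ]

theorem seg_snoc (hij : i ≤ j) : seg x e g i (j + 1) = seg x e g i j * x (g * e j) := by
  obtain ⟨d, rfl⟩ := Nat.exists_eq_add_of_le hij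
  have h1 : i + d + 1 - i = d + 1 := by omega
  have h2 : i + d - i = d := by omega
  simp [seg, h1, h2, List.range'_concat]

theorem seg_snoc' (hij : i < j) :
    seg x e g i j = seg x e g i (j - 1) * x (g * e (j - 1)) := by
  obtain ⟨j, rfl⟩ : ∃ m, j = m + 1 := ⟨j - 1, by omega⟩
  exact seg_snoc (by omega)

theorem seg_single : seg x e g i (i + 1) = x (g * e i) := by
  rw [seg_snoc le_rfl, seg_self, one_mul]

/-- Passing to the opposite monoid reads the words backwards. -/
theorem seg_op (hij : i ≤ j) (hj : j ≤ n) :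
    seg (fun a => op (x a)) (fun m => e (n - 1 - m)) g i j = op (seg x e g (n - j) (n - i)) := by
  induction j, hij using Nat.le_induction with
  | base => rw [seg_self, seg_self, op_one]
  | succ j hl ih =>
    have h1 : n - 1 - j = n - (j + 1) := by omega
    have h2 : n - (j + 1) + 1 = n - j := by omega
    rw [seg_snoc hl, ih (by omega), seg_cons (i := n - (j + 1)) (by omega), h1, h2, op_mul]

end Segments

/-! ### Quotients of consecutive letters -/

section Profile
variable {Γ : Type*} [Group Γ]

/-- The quotients of consecutive letters along the words: `2 * k - 1` times `τ`, then `v` once,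
then `2 * k - 1` times `τ⁻¹`. -/
def ratio (k : ℕ) (τ v : Γ) (i : ℕ) : Γ :=
  if i + 1 < 2 * k then τ else if i + 1 = 2 * k then v else τ⁻¹

/-- The sequence `e 0, …, e (n - 1)` has `n = 4 * k ≥ 8` terms, and consecutive quotients
`τ, …, τ, v, τ⁻¹, …, τ⁻¹` with `τ`, `v`, `τ⁻¹` distinct. -/
structure RatioProfile (e : ℕ → Γ) (n k : ℕ) (τ v : Γ) : Prop where
  n_eq : n = 4 * k
  two_le : 2 ≤ k
  ne_inv : τ ≠ τ⁻¹
  ne_left : v ≠ τ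
  ne_right : v ≠ τ⁻¹
  step : ∀ i, i + 1 < n → e (i + 1) = e i * ratio k τ v i

namespace RatioProfile
variable {e : ℕ → Γ} {n k : ℕ} {τ v g h : Γ} (P : RatioProfile e n k τ v) {i j : ℕ}
include P

theorem ratio_eq_iff : ratio k τ v i = ratio k τ v j ↔
    (i + 1 < 2 * k ∧ j + 1 < 2 * k) ∨ (i + 1 = 2 * k ∧ j + 1 = 2 * k) ∨
      (2 * k < i + 1 ∧ 2 * k < j + 1) := by
  have h1 := P.ne_inv
  have h2 := P.ne_left
  have h3 := P.ne_right
  unfold ratio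
  split_ifs <;> simp only [h1, h2, h3, h1.symm, h2.symm, h3.symm, false_iff, true_iff] <;> omega

/-- The reversed sequence has the same profile, with `v` replaced by `v⁻¹`. -/
theorem op : RatioProfile (fun m => e (n - 1 - m)) n k τ v⁻¹ where
  n_eq := P.n_eq
  two_le := P.two_le
  ne_inv := P.ne_inv
  ne_left := fun h => P.ne_right (by rw [← h, inv_inv])
  ne_right := fun h => P.ne_left (inv_injective h)
  step := fun i hi => by
    have hs := P.step (n - 2 - i) (by omega)
    have h1 : n - 2 - i + 1 = n - 1 - i := by omega
    have h2 : n - 1 - (i + 1) = n - 2 - i := by omega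
    have h3 : ratio k τ v⁻¹ i = (ratio k τ v (n - 2 - i))⁻¹ := by
      have := P.n_eq
      unfold ratio
      split_ifs <;> first | omega | simp
    simp only [h2, h3]
    rw [h1] at hs
    rw [hs, mul_inv_cancel_right]

theorem ratio_of_eq (hi : i + 1 < n) (hj : j + 1 < n) (h0 : g * e i = h * e j)
    (h1 : g * e (i + 1) = h * e (j + 1)) : ratio k τ v i = ratio k τ v j := by
  rw [P.step i hi, P.step j hj, ← mul_assoc, ← mul_assoc, h0] at h1
  exact mul_left_cancel h1

theorem step_zero : e 1 = e 0 * τ := by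
  have h1 := P.n_eq
  have h2 := P.two_le
  rw [P.step 0 (by omega), ratio, if_pos (by omega)]

theorem step_one : e 2 = e 1 * τ := by
  have h1 := P.n_eq
  have h2 := P.two_le
  rw [P.step 1 (by omega), ratio, if_pos (by omega)]

theorem step_down (hi : 2 * k ≤ i) (hi' : i + 1 < n) : e i = e (i + 1) * τ := by
  rw [P.step i hi', ratio, if_neg (by omega), if_neg (by omega), inv_mul_cancel_right]

/-- Distinct words overlap in at most one letter: a proper suffix of length at least two of one
word is not a prefix of another. -/
theorem exists_ne_of_overlap (g h : Γ) (hi : 1 ≤ i) (hi' : i + 2 ≤ n) :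
    ∃ m, i + m < n ∧ g * e (i + m) ≠ h * e m := by
  by_contra! hc
  have hn := P.n_eq
  have hk := P.two_le
  have key : ∀ m, i + m + 1 < n → ratio k τ v (i + m) = ratio k τ v m := fun m hm =>
    P.ratio_of_eq (by omega) (by omega) (hc m (by omega)) (hc (m + 1) (by omega))
  by_cases h2 : i < 2 * k
  · have := P.ratio_eq_iff.1 (key (2 * k - 1) (by omega))
    omega
  · have := P.ratio_eq_iff.1 (key 0 (by omega))
    omega

/-- The quotient between positions `i - 1` and `i` is determined by the two neighbouring ones.
No condition is imposed for a neighbour of `j` that falls outside the word. -/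
theorem ratio_eq_of_neighbours (hi : 2 ≤ i) (hi' : i + 2 ≤ n) (hj : 1 ≤ j) (hj' : j + 1 ≤ n)
    (hl : 2 ≤ j → ratio k τ v (i - 2) = ratio k τ v (j - 2))
    (hr : j + 2 ≤ n → ratio k τ v i = ratio k τ v j) :
    ratio k τ v (i - 1) = ratio k τ v (j - 1) := by
  have hn := P.n_eq
  have hk := P.two_le
  rw [P.ratio_eq_iff] at hl hr ⊢
  omega

end RatioProfile
end Profile

/-! ### Rigidity of factorizations -/

section WordSystem
variable {Γ M : Type*} [Group Γ] [Monoid M]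

/-- A graded monoid generated by the letters `x a`, of degree `len (x a) = 1`, in which all the words
`w_g = x (g * e 0) ⋯ x (g * e (n - 1))` agree, and in which the common right (left) multiples of
two distinct letters are the right (left) multiples of that common value. -/
structure WordSystem (x : Γ → M) (e : ℕ → Γ) (n : ℕ) (len : M → ℕ) : Prop where
  len_mul : ∀ a b, len (a * b) = len a + len b
  len_letter : ∀ a, len (x a) = 1
  exists_head : ∀ m, m = 1 ∨ ∃ a m', m = x a * m'
  exists_last : ∀ m, m = 1 ∨ ∃ a m', m = m' * x a
  seg_eq : ∀ g h, seg x e g 0 n = seg x e h 0 n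
  head : ∀ {a b m m'}, x a * m = x b * m' → (a = b ∧ m = m') ∨ (a ≠ b ∧
    ∃ m₀, m = seg x e (a * (e 0)⁻¹) 1 n * m₀ ∧ m' = seg x e (b * (e 0)⁻¹) 1 n * m₀)
  last : ∀ {a b m m'}, m * x a = m' * x b → (a = b ∧ m = m') ∨ (a ≠ b ∧
    ∃ m₀, m = m₀ * seg x e (a * (e (n - 1))⁻¹) 0 (n - 1) ∧
      m' = m₀ * seg x e (b * (e (n - 1))⁻¹) 0 (n - 1))

namespace WordSystem
variable {x : Γ → M} {e : ℕ → Γ} {n : ℕ} {len : M → ℕ} {g h a b : Γ} {i j : ℕ} {c c' d d' m m' : M}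

/-- The opposite monoid is a word system for the reversed words. -/
theorem op (S : WordSystem x e n len) (hn : 1 ≤ n) :
    WordSystem (fun a => op (x a)) (fun m => e (n - 1 - m)) n (fun m => len (unop m)) where
  len_mul a b := by rw [unop_mul, S.len_mul, add_comm]
  len_letter a := S.len_letter a
  exists_head m := by
    rcases S.exists_last (unop m) with h | ⟨a, m', h⟩
    · exact .inl (unop_injective h)
    · exact .inr ⟨a, .op m', unop_injective h⟩
  exists_last m := by
    rcases S.exists_head (unop m) with h | ⟨a, m', h⟩
    · exact .inl (unop_injective h)
    · exact .inr ⟨a, .op m', unop_injective h⟩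
  seg_eq g h := by
    rw [seg_op (Nat.zero_le _) le_rfl, seg_op (Nat.zero_le _) le_rfl]
    simp only [Nat.sub_self, Nat.sub_zero, S.seg_eq g h]
  head {a b m m'} hab := by
    rcases S.last (congrArg unop hab) with ⟨h1, h2⟩ | ⟨h1, m₀, h2, h3⟩
    · exact .inl ⟨h1, unop_injective h2⟩
    · refine .inr ⟨h1, .op m₀, unop_injective ?_, unop_injective ?_⟩ <;>
        rw [seg_op hn le_rfl] <;> simpa
  last {a b m m'} hab := by
    rcases S.head (congrArg unop hab) with ⟨h1, h2⟩ | ⟨h1, m₀, h2, h3⟩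
    · exact .inl ⟨h1, unop_injective h2⟩
    · have h4 : n - (n - 1) = 1 := by omega
      refine .inr ⟨h1, .op m₀, unop_injective ?_, unop_injective ?_⟩ <;>
        rw [seg_op (Nat.zero_le _) (Nat.sub_le _ _)] <;> simpa [h4]

variable (S : WordSystem x e n len)
include S

theorem len_one : len 1 = 0 := by
  have := S.len_mul 1 1
  rw [one_mul] at this
  omega

theorem len_seg (hij : i ≤ j) : len (seg x e g i j) = j - i := by
  induction j, hij using Nat.le_induction with
  | base => rw [seg_self, S.len_one, Nat.sub_self]
  | succ j hl ih => rw [seg_snoc hl, S.len_mul, ih, S.len_letter]; omega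

theorem letter_mul_cancel (h : x a * m = x a * m') : m = m' := by
  rcases S.head h with ⟨-, h⟩ | ⟨h, -⟩
  · exact h
  · exact absurd rfl h

theorem mul_left_cancel_of (h : c * m = c * m') : m = m' := by
  induction hl : len c generalizing c with
  | zero =>
    rcases S.exists_head c with rfl | ⟨a, c', rfl⟩
    · simpa using h
    · rw [S.len_mul, S.len_letter] at hl; omega
  | succ l ih =>
    rcases S.exists_head c with rfl | ⟨a, c', rfl⟩
    · simpa using h
    · rw [S.len_mul, S.len_letter] at hl
      rw [mul_assoc, mul_assoc] at h
      exact ih (S.letter_mul_cancel h) (by omega)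

theorem head_of_ne (hn : 1 ≤ n) (hab : a ≠ b) (h : x a * m = x b * m') (g : Γ) :
    ∃ m₀, x a * m = seg x e g 0 n * m₀ := by
  rcases S.head h with ⟨h, -⟩ | ⟨-, m₀, h1, -⟩
  · exact absurd h hab
  · refine ⟨m₀, ?_⟩
    rw [h1, S.seg_eq g (a * (e 0)⁻¹), seg_cons (i := 0) hn, inv_mul_cancel_right, mul_assoc]

variable {k : ℕ} {τ v : Γ} (P : RatioProfile e n k τ v)
include P

/-- A right multiple of a proper suffix of length at least two of a word is never a right multiple
of the full word. Comparing the two letter by letter, the first discrepancy produces a shorter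
coincidence of the same kind. -/
theorem suffix_mul_ne (hi : 1 ≤ i) (hi' : i + 2 ≤ n) :
    seg x e g i n * d ≠ seg x e h 0 n * m := by
  induction hl : len d using Nat.strong_induction_on generalizing g h i d m with
  | _ L ih =>
    intro heq
    rw [S.seg_eq h (g * e i * (e 0)⁻¹)] at heq
    set h' := g * e i * (e 0)⁻¹ with hh'
    have hlen := congrArg len heq
    rw [S.len_mul, S.len_mul, S.len_seg (by omega), S.len_seg (by omega)] at hlen
    have key : ∀ l, i + l ≤ n → (∀ m < l, g * e (i + m) = h' * e m) ∧
        seg x e g (i + l) n * d = seg x e h' l n * m := by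
      intro l
      induction l with
      | zero => exact fun _ => ⟨fun _ h => absurd h (Nat.not_lt_zero _), heq⟩
      | succ l ihl =>
        intro hle
        obtain ⟨h1, h2⟩ := ihl (by omega)
        rw [seg_cons (by omega), seg_cons (i := l) (by omega), mul_assoc, mul_assoc] at h2
        by_cases hab : g * e (i + l) = h' * e l
        · refine ⟨fun m hm => ?_, ?_⟩
          · rcases Nat.lt_succ_iff_lt_or_eq.1 hm with hm | rfl
            · exact h1 m hm
            · exact hab
          · rw [hab] at h2
            exact S.letter_mul_cancel h2
        · -- At `l = 0` the letters agree by the choice of `h'`, so `l ≥ 1` and the suffix of `w_h'`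
          -- that remains is proper; `m` is shorter than `d`.
          have hl0 : l ≠ 0 := by
            rintro rfl
            exact hab (by simp [hh'])
          obtain ⟨m₀, h3⟩ := S.head_of_ne (by omega) (Ne.symm hab) h2.symm 1
          rw [← mul_assoc, ← seg_cons (by omega)] at h3
          exact (ih (len m) (by omega) (by omega) (by omega) rfl h3).elim
    obtain ⟨m', hm', hne⟩ := P.exists_ne_of_overlap g h' hi hi'
    exact hne ((key (m' + 1) (by omega)).1 m' (by omega))

/-- A right multiple of a proper suffix of length at least two has a unique first letter. -/
theorem suffix_head (hi : 1 ≤ i) (hi' : i + 2 ≤ n) (h : seg x e g i n * d = x b * m) :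
    b = g * e i ∧ m = seg x e g (i + 1) n * d := by
  rw [seg_cons (by omega), mul_assoc] at h
  by_cases hab : g * e i = b
  · subst hab
    exact ⟨rfl, (S.letter_mul_cancel h).symm⟩
  · obtain ⟨m₀, h3⟩ := S.head_of_ne (by omega) hab h 1
    rw [← mul_assoc, ← seg_cons (by omega)] at h3
    exact (S.suffix_mul_ne P hi hi' h3).elim

/-- A left multiple of a proper prefix of length at least two has a unique last letter. -/
theorem prefix_last (hj : 2 ≤ j) (hj' : j + 1 ≤ n) (h : c * seg x e g 0 j = m * x b) :
    b = g * e (j - 1) ∧ m = c * seg x e g 0 (j - 1) := by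
  have h0 := (S.op (by omega)).suffix_head P.op (i := n - j) (g := g) (d := .op c) (b := b)
    (m := .op m) (by omega) (by omega) (by
      rw [seg_op (by omega) le_rfl, ← op_mul, ← op_mul, Nat.sub_self,
        Nat.sub_sub_self (by omega), h])
  have h1 : n - 1 - (n - j) = j - 1 := by omega
  have h2 : n - (n - j + 1) = j - 1 := by omega
  rw [seg_op (by omega) le_rfl, ← op_mul, Nat.sub_self, h1, h2] at h0
  exact ⟨h0.1, op_injective h0.2⟩

/-- Two coinciding right multiples of proper suffixes share their first letters: the first one,
and the second one if both suffixes are long enough. -/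
theorem suffix_suffix (hi : 1 ≤ i) (hi' : i + 2 ≤ n) (hj : 1 ≤ j) (hj' : j + 1 ≤ n)
    (heq : seg x e g i n * d = seg x e h j n * d') :
    g * e i = h * e j ∧ (j + 2 ≤ n → i ≠ j → g * e (i + 1) = h * e (j + 1)) := by
  have h0 := heq
  rw [seg_cons (i := j) (by omega), mul_assoc] at h0
  obtain ⟨h1, h2⟩ := S.suffix_head P hi hi' h0
  refine ⟨h1.symm, fun hj2 hne => ?_⟩
  by_cases hi3 : i + 3 ≤ n
  · rw [seg_cons (by omega), mul_assoc] at h2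
    exact (S.suffix_head P (by omega) (by omega) h2.symm).1.symm
  · rw [seg_cons (i := i + 1) (by omega), mul_assoc] at h2
    exact (S.suffix_head P (by omega) (by omega) h2).1

theorem prefix_prefix (hi : 2 ≤ i) (hi' : i + 1 ≤ n) (hj : 1 ≤ j) (hj' : j + 1 ≤ n)
    (heq : c * seg x e g 0 i = c' * seg x e h 0 j) :
    g * e (i - 1) = h * e (j - 1) ∧ (2 ≤ j → i ≠ j → g * e (i - 2) = h * e (j - 2)) := by
  have h0 := (S.op (by omega)).suffix_suffix P.op (i := n - i) (j := n - j) (g := g) (h := h)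
    (d := .op c) (d' := .op c') (by omega) (by omega) (by omega) (by omega) (by
      rw [seg_op (by omega) le_rfl, seg_op (by omega) le_rfl, ← op_mul, ← op_mul, Nat.sub_self,
        Nat.sub_sub_self (by omega), Nat.sub_sub_self (by omega), heq])
  have h1 : n - 1 - (n - i) = i - 1 := by omega
  have h2 : n - 1 - (n - j) = j - 1 := by omega
  have h3 : n - 1 - (n - i + 1) = i - 2 := by omega
  have h4 : n - 1 - (n - j + 1) = j - 2 := by omega
  simp only [h1, h2, h3, h4] at h0
  exact ⟨h0.1, fun h5 h6 => h0.2 (by omega) (by omega)⟩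

/-- A left factor of a right multiple of a suffix of a word either stops inside the suffix, or
runs through all its letters but the last one. -/
theorem left_factor_suffix (hj : 1 ≤ j) (hj' : j + 1 ≤ n) (heq : c * d = seg x e g j n * m) :
    (∃ i, j ≤ i ∧ i + 1 ≤ n ∧ c = seg x e g j i ∧ d = seg x e g i n * m) ∨
      ∃ a r, c = seg x e g j (n - 1) * (x a * r) ∧ x a * r * d = x (g * e (n - 1)) * m := by
  induction hl : n - j generalizing j c with
  | zero => omega
  | succ l ih =>
    rcases S.exists_head c with rfl | ⟨b, c', rfl⟩
    · exact .inl ⟨j, le_rfl, hj', (seg_self ..).symm, by simpa using heq⟩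
    by_cases hj2 : j + 2 ≤ n
    · rw [mul_assoc] at heq
      obtain ⟨rfl, h2⟩ := S.suffix_head P hj hj2 heq.symm
      rcases ih (by omega) (by omega) h2 (by omega) with ⟨i, h3, h4, rfl, h6⟩ | ⟨a, r, rfl, h4⟩
      · exact .inl ⟨i, by omega, h4, (seg_cons (by omega)).symm, h6⟩
      · exact .inr ⟨a, r, by rw [← mul_assoc, ← seg_cons (by omega)], h4⟩
    · obtain rfl : j = n - 1 := by omega
      refine .inr ⟨b, c', by rw [seg_self, one_mul], ?_⟩
      rw [heq, seg_cons (by omega), Nat.sub_add_cancel (by omega), seg_self, mul_one]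

/-- Two different factorizations of an element with left factors of the same length are obtained
by cutting two different words in the same position. -/
theorem exists_cut (heq : c * d = c' * d') (hlen : len c = len c') (hne : c ≠ c') :
    ∃ p g h i q, 1 ≤ i ∧ i + 1 ≤ n ∧ g ≠ h ∧ c = p * seg x e g 0 i ∧ d = seg x e g i n * q ∧
      c' = p * seg x e h 0 i ∧ d' = seg x e h i n * q := by
  have hn := P.n_eq
  have hk := P.two_le
  induction hl : len c using Nat.strong_induction_on generalizing c c' with
  | _ L ih =>
    by_cases hcom : ∃ a f f', c = x a * f ∧ c' = x a * f'
    · obtain ⟨a, f, f', rfl, rfl⟩ := hcom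
      rw [mul_assoc, mul_assoc] at heq
      rw [S.len_mul, S.len_letter] at hl
      rw [S.len_mul, S.len_mul, S.len_letter] at hlen
      obtain ⟨p, g, h, i, q, h1, h2, h3, rfl, rfl, rfl, rfl⟩ :=
        ih (len f) (by omega) (S.letter_mul_cancel heq) (by omega) (fun h => hne (by rw [h])) rfl
      exact ⟨x a * p, g, h, i, q, h1, h2, h3, (mul_assoc ..).symm, rfl, (mul_assoc ..).symm, rfl⟩
    rcases S.exists_head c with rfl | ⟨a, f, rfl⟩
    · rcases S.exists_head c' with rfl | ⟨b, f', rfl⟩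
      · exact absurd rfl hne
      · rw [S.len_one, S.len_mul, S.len_letter] at hlen; omega
    rcases S.exists_head c' with rfl | ⟨b, f', rfl⟩
    · rw [S.len_one, S.len_mul, S.len_letter] at hlen; omega
    have hab : a ≠ b := by
      rintro rfl
      exact hcom ⟨a, f, f', rfl, rfl⟩
    rw [mul_assoc, mul_assoc] at heq
    obtain ⟨h, -⟩ | ⟨-, m₀, h1, h2⟩ := S.head heq
    · exact absurd h hab
    obtain ⟨g, rfl⟩ : ∃ g, a = g * e 0 := ⟨a * (e 0)⁻¹, by simp⟩
    obtain ⟨h, rfl⟩ : ∃ h, b = h * e 0 := ⟨b * (e 0)⁻¹, by simp⟩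
    rw [mul_inv_cancel_right] at h1 h2
    have hgh : g ≠ h := fun h => hab (by rw [h])
    -- The left factors have no common first letter, so they are not divisible by a full word.
    have hfull : ∀ (y g' : Γ) (r : M), x (g' * e 0) * (seg x e g' 1 (n - 1) *
        (x (g' * e (n - 1)) * r)) = x y * (seg x e (y * (e 0)⁻¹) 1 n * r) := by
      intro y g' r
      rw [← mul_assoc, ← mul_assoc, ← seg_cons (by omega), ← seg_snoc' (by omega),
        S.seg_eq g' (y * (e 0)⁻¹), seg_cons (i := 0) (by omega), inv_mul_cancel_right, mul_assoc]
    rw [S.len_mul, S.len_mul, S.len_letter, S.len_letter] at hlen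
    rcases S.left_factor_suffix P le_rfl (by omega) h1 with
      ⟨i, hi, hi', rfl, rfl⟩ | ⟨y, r, rfl, hr⟩ <;>
    rcases S.left_factor_suffix P le_rfl (by omega) h2 with
      ⟨i', hj, hj', rfl, rfl⟩ | ⟨y', r', rfl, hr'⟩
    · rw [S.len_seg hi, S.len_seg hj] at hlen
      obtain rfl : i = i' := by omega
      refine ⟨1, g, h, i, m₀, hi, hi', hgh, ?_, rfl, ?_, rfl⟩ <;>
        rw [one_mul, ← seg_cons (by omega)]
    · rw [S.len_mul, S.len_mul, S.len_letter, S.len_seg hi, S.len_seg (by omega)] at hlen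
      omega
    · rw [S.len_mul, S.len_mul, S.len_letter, S.len_seg hj, S.len_seg (by omega)] at hlen
      omega
    · -- Both left factors run past the last letter of their word, so both remainders start
      -- another full word with that letter. Without their first letters, these two words have
      -- the common right multiple `m₀`, hence equal first letters, which forces `g = h`.
      have hy : y ≠ g * e (n - 1) := by
        rintro rfl
        exact hcom ⟨_, _, _, hfull (h * e 0) g r, rfl⟩
      have hy' : y' ≠ h * e (n - 1) := by
        rintro rfl
        exact hcom ⟨_, _, _, rfl, hfull (g * e 0) h r'⟩
      rw [mul_assoc] at hr hr'
      obtain ⟨h, -⟩ | ⟨-, m₁, -, h3⟩ := S.head hr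
      · exact absurd h hy
      obtain ⟨h, -⟩ | ⟨-, m₂, -, h4⟩ := S.head hr'
      · exact absurd h hy'
      have h5 := (S.suffix_suffix P le_rfl (by omega) le_rfl (by omega) (h3.symm.trans h4)).1
      exact absurd (by simpa using h5) hgh

end WordSystem
end WordSystem

/-! ### Reduction to sets of elements of constant length -/

section TwoUnique
variable {M : Type*} [Mul M]

/-- The product set of `A` and `B` has two uniquely represented elements. -/
def HasTwoUnique (A B : Finset M) : Prop :=
  ∃ c ∈ A, ∃ d ∈ B, ∃ c' ∈ A, ∃ d' ∈ B,
    (c ≠ c' ∨ d ≠ d') ∧ UniqueMul A B c d ∧ UniqueMul A B c' d'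

theorem HasTwoUnique.of_op {A B : Finset M}
    (h : HasTwoUnique (B.map ⟨op, op_injective⟩) (A.map ⟨op, op_injective⟩)) :
    HasTwoUnique A B := by
  obtain ⟨c, hc, d, hd, c', hc', d', hd', hne, h1, h2⟩ := h
  simp only [Finset.mem_map, Function.Embedding.coeFn_mk] at hc hd hc' hd'
  obtain ⟨b, hb, rfl⟩ := hc
  obtain ⟨a, ha, rfl⟩ := hd
  obtain ⟨b', hb', rfl⟩ := hc'
  obtain ⟨a', ha', rfl⟩ := hd'
  exact ⟨a, ha, b, hb, a', ha', b', hb',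
    hne.symm.imp (mt (congrArg op)) (mt (congrArg op)), h1.of_mulOpposite, h2.of_mulOpposite⟩

/-- In a monoid graded by an additive length, it is enough to treat sets of elements of constant
length: pass to the extreme lengths. -/
theorem twoUniqueProds_of_homogeneous (len : M → ℕ) (hlen : ∀ a b, len (a * b) = len a + len b)
    (H : ∀ A B : Finset M, (∀ a ∈ A, ∀ a' ∈ A, len a = len a') →
      (∀ b ∈ B, ∀ b' ∈ B, len b = len b') → 1 < A.card * B.card → HasTwoUnique A B) :
    TwoUniqueProds M := by
  classical
  refine ⟨fun {A B} hc => ?_⟩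
  obtain ⟨hA, hB, -⟩ := Nat.one_lt_mul_iff.1 hc
  let f : M →ₙ* Multiplicative ℕ :=
    ⟨fun a => Multiplicative.ofAdd (len a), fun a b => by rw [hlen, ofAdd_add]⟩
  have hf : ∀ a b, f a = f b ↔ len a = len b := fun a b => Iff.rfl
  -- If several lengths occur, two unique products of lengths each contain a unique product;
  -- otherwise `A` and `B` are themselves homogeneous.
  by_cases h1 : 1 < (A.image f).card * (B.image f).card
  · obtain ⟨p, hp, q, hq, hne, hup, huq⟩ := TwoUniqueProds.uniqueMul_of_one_lt_card h1
    have key : ∀ p ∈ A.image f ×ˢ B.image f, UniqueMul (A.image f) (B.image f) p.1 p.2 →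
        ∃ c ∈ A, ∃ d ∈ B, (f c, f d) = p ∧ UniqueMul A B c d := by
      intro p hp hu
      obtain ⟨hp1, hp2⟩ := Finset.mem_product.1 hp
      obtain ⟨a, ha, hap⟩ := Finset.mem_image.1 hp1
      obtain ⟨b, hb, hbp⟩ := Finset.mem_image.1 hp2
      have hA' : (A.filter fun a => f a = p.1).Nonempty := ⟨a, by simp [ha, hap]⟩
      have hB' : (B.filter fun a => f a = p.2).Nonempty := ⟨b, by simp [hb, hbp]⟩
      obtain ⟨c, hc, d, hd, hu'⟩ : ∃ c ∈ A.filter fun a => f a = p.1,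
          ∃ d ∈ B.filter fun a => f a = p.2, UniqueMul (A.filter fun a => f a = p.1)
            (B.filter fun a => f a = p.2) c d := by
        by_cases hcard : 1 < (A.filter fun a => f a = p.1).card *
          (B.filter fun a => f a = p.2).card
        · obtain ⟨c, hc, d, hd, -, -, -, -, -, hu', -⟩ := H _ _
            (fun a ha a' ha' => (hf _ _).1 ((Finset.mem_filter.1 ha).2.trans
              (Finset.mem_filter.1 ha').2.symm))
            (fun a ha a' ha' => (hf _ _).1 ((Finset.mem_filter.1 ha).2.trans
              (Finset.mem_filter.1 ha').2.symm)) hcard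
          exact ⟨c, hc, d, hd, hu'⟩
        · have h2 := hA'.card_pos
          have h3 := hB'.card_pos
          exact UniqueMul.of_card_le_one hA' hB' (by nlinarith) (by nlinarith)
      rw [Finset.mem_filter] at hc hd
      exact ⟨c, hc.1, d, hd.1, Prod.ext hc.2 hd.2, hu.of_image_filter f hc.2 hd.2 hu'⟩
    obtain ⟨c, hc, d, hd, rfl, hu⟩ := key p hp hup
    obtain ⟨c', hc', d', hd', rfl, hu'⟩ := key q hq huq
    refine ⟨(c, d), Finset.mem_product.2 ⟨hc, hd⟩, (c', d'), Finset.mem_product.2 ⟨hc', hd'⟩,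
      fun h => hne ?_, hu, hu'⟩
    obtain ⟨rfl, rfl⟩ := Prod.ext_iff.1 h
    rfl
  · have h2 := (Finset.card_pos.1 hA).image f |>.card_pos
    have h3 := (Finset.card_pos.1 hB).image f |>.card_pos
    have h4 : (A.image f).card ≤ 1 := by nlinarith
    have h5 : (B.image f).card ≤ 1 := by nlinarith
    obtain ⟨c, hc, d, hd, c', hc', d', hd', hne, h1, h2⟩ := H A B
      (fun a ha a' ha' => (hf _ _).1 (Finset.card_le_one.1 h4 _ (Finset.mem_image_of_mem _ ha) _
        (Finset.mem_image_of_mem _ ha')))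
      (fun a ha a' ha' => (hf _ _).1 (Finset.card_le_one.1 h5 _ (Finset.mem_image_of_mem _ ha) _
        (Finset.mem_image_of_mem _ ha'))) hc
    refine ⟨(c, d), Finset.mem_product.2 ⟨hc, hd⟩, (c', d'), Finset.mem_product.2 ⟨hc', hd'⟩,
      fun h => ?_, h1, h2⟩
    rcases hne with hne | hne
    · exact hne (Prod.ext_iff.1 h).1
    · exact hne (Prod.ext_iff.1 h).2

end TwoUnique

/-! ### Unique products from exchanged cuts -/

namespace WordSystem
variable {Γ M : Type*} [Group Γ] [Monoid M]
variable {x : Γ → M} {e : ℕ → Γ} {n : ℕ} {len : M → ℕ} {g h g' : Γ} {i j : ℕ} {c c' d d' p q : M}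
variable (S : WordSystem x e n len) {k : ℕ} {τ v : Γ} (P : RatioProfile e n k τ v)
include S P

/-- A product that is not uniquely represented comes from cutting a word. -/
theorem exists_cut_of_not_unique {A B : Finset M} (hA : ∀ a ∈ A, ∀ a' ∈ A, len a = len a')
    (hc : c ∈ A) (hu : ¬ UniqueMul A B c d) :
    ∃ p g h i q, 1 ≤ i ∧ i + 1 ≤ n ∧ g ≠ h ∧ c = p * seg x e g 0 i ∧ d = seg x e g i n * q ∧
      p * seg x e h 0 i ∈ A ∧ seg x e h i n * q ∈ B := by
  unfold UniqueMul at hu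
  push Not at hu
  obtain ⟨c', d', hc', hd', heq, hne⟩ := hu
  have hcc : c ≠ c' := by
    rintro rfl
    exact hne rfl (S.mul_left_cancel_of heq)
  obtain ⟨p, g, h, i, q, h1, h2, h3, rfl, rfl, rfl, rfl⟩ :=
    S.exists_cut P heq.symm (hA _ hc _ hc') hcc
  exact ⟨p, g, h, i, q, h1, h2, h3, rfl, rfl, hc', hd'⟩

/-- Exchanging the second halves of two words cut at least two letters away from both ends gives
a product that no word crosses at the cut. -/
theorem not_cut_of_middle (hi : 2 ≤ i) (hi' : i + 2 ≤ n) (hgh : g ≠ h) (hj : 1 ≤ j)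
    (hj' : j + 1 ≤ n) (h1 : c * seg x e g 0 i = p * seg x e g' 0 j)
    (h2 : seg x e h i n * d = seg x e g' j n * q) : False := by
  obtain ⟨h3, h4⟩ := S.prefix_prefix P hi (by omega) hj hj' h1
  obtain ⟨h5, h6⟩ := S.suffix_suffix P (by omega) hi' hj hj' h2
  by_cases hij : i = j
  · subst hij
    exact hgh ((mul_right_cancel h3).trans (mul_right_cancel h5).symm)
  have e1 : ∀ m, 1 ≤ m → m - 1 + 1 = m := fun m hm => by omega
  have e2 : ∀ m, 2 ≤ m → m - 2 + 1 = m - 1 := fun m hm => by omega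
  have h7 : ratio k τ v (i - 1) = ratio k τ v (j - 1) := by
    refine P.ratio_eq_of_neighbours hi hi' hj hj' (fun hj2 => ?_) (fun hj2 => ?_)
    · refine P.ratio_of_eq (g := g) (h := g') (by omega) (by omega) (h4 hj2 hij) ?_
      rw [e2 i hi, e2 j hj2, h3]
    · exact P.ratio_of_eq (by omega) (by omega) h5 (h6 hj2 hij)
  have h8 := P.step (i - 1) (by omega)
  have h9 := P.step (j - 1) (by omega)
  rw [e1 i (by omega)] at h8
  rw [e1 j hj] at h9
  rw [h8, h9, h7, ← mul_assoc, ← mul_assoc] at h5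
  have h10 := mul_right_cancel h5
  rw [← h3] at h10
  exact hgh (mul_right_cancel h10).symm

/-- Let two words be cut after their first letter and exchange their second parts. If a word
crosses the new product at the cut, it does so either after the first or before the last of its
letters. In both cases the left factor that remains when `x (g * e 0)` is split off has
`x (g * e 0 * τ)` as its only possible last letter. -/
theorem cut_of_cross (hgh : g ≠ h) (hj : 1 ≤ j)
    (hj' : j + 1 ≤ n) (h1 : c * x (g * e 0) = p * seg x e g' 0 j)
    (h2 : seg x e h 1 n * d = seg x e g' j n * q) :
    ((j = 1 ∧ g' = h) ∨ j + 1 = n) ∧ (∃ c₀, c = c₀ * x (g * e 0 * τ)) ∧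
      ∀ c₀ b, c = c₀ * x b → b = g * e 0 * τ := by
  have hn := P.n_eq
  have hk := P.two_le
  have only : ∀ (c c₁ : M) (y : Γ) (m : ℕ), 2 ≤ m → m + 1 ≤ n → c = c₁ * seg x e y 0 m →
      y * e (m - 1) = g * e 0 * τ → (∃ c₀, c = c₀ * x (g * e 0 * τ)) ∧
        ∀ c₀ b, c = c₀ * x b → b = g * e 0 * τ := by
    rintro c c₁ y m hm hm' rfl hy
    refine ⟨⟨c₁ * seg x e y 0 (m - 1), ?_⟩, fun c₀ b hb => ?_⟩
    · rw [seg_snoc' (by omega), hy, ← mul_assoc]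
    · rw [(S.prefix_last P hm hm' hb).1, hy]
  obtain ⟨h5, h6⟩ := S.suffix_suffix P le_rfl (by omega) hj hj' h2
  by_cases hj1 : j = 1
  · subst hj1
    have hh : g' = h := (mul_right_cancel h5).symm
    subst hh
    refine ⟨.inl ⟨rfl, rfl⟩, ?_⟩
    rw [seg_single] at h1
    obtain ⟨h, -⟩ | ⟨-, m₀, h3, -⟩ := S.last h1
    · exact absurd (mul_right_cancel h) hgh
    · refine only _ _ _ (n - 1) (by omega) (by omega) h3 ?_
      have := P.step_down (i := n - 1 - 1) (by omega) (by omega)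
      rw [this, Nat.sub_add_cancel (by omega), ← mul_assoc, inv_mul_cancel_right]
  obtain ⟨h3, h4⟩ := S.prefix_last P (by omega) hj' h1.symm
  -- If the crossing word has two letters beyond the cut, then their quotient is `τ`, as in `w_h`.
  -- So the quotient at the cut is `τ` as well, in both words, and this forces `g = h`.
  by_cases hjn : j + 1 = n
  · refine ⟨.inr hjn, only _ _ _ (j - 1) (by omega) (by omega) h4 ?_⟩
    have := P.step_down (i := j - 1 - 1) (by omega) (by omega)
    rw [this, Nat.sub_add_cancel (by omega), ← mul_assoc, h3]
  · have h7 := P.ratio_eq_iff.1 (P.ratio_of_eq (by omega) (by omega) h5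
      (h6 (by omega) (Ne.symm hj1)))
    have h8 := P.step (j - 1) (by omega)
    rw [Nat.sub_add_cancel hj, ratio, if_pos (by omega)] at h8
    rw [h8, P.step_zero, ← mul_assoc, ← mul_assoc] at h5
    have h9 := mul_right_cancel h5
    rw [← h3] at h9
    exact absurd (mul_right_cancel h9).symm hgh

/-- The mirror image of `cut_of_cross`, for words cut before their last letter. -/
theorem head_of_cross (hgh : g ≠ h) (hj : 1 ≤ j)
    (hj' : j + 1 ≤ n) (h1 : c * seg x e g 0 (n - 1) = p * seg x e g' 0 j)
    (h2 : x (h * e (n - 1)) * d = seg x e g' j n * q) {b : Γ} (hd : d = x b * d') :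
    b = h * e (n - 1) * τ := by
  have hn := P.n_eq
  have hk := P.two_le
  have h0 := (S.op (by omega)).cut_of_cross P.op (g := h) (h := g) (j := n - j) (g' := g')
    (c := .op d) (p := .op q) (d := .op c) (q := .op p) hgh.symm (by omega) (by omega)
    (by rw [seg_op (by omega) (by omega), Nat.sub_sub_self (by omega), ← op_mul, Nat.sub_zero,
          Nat.sub_zero, ← op_mul, h2])
    (by rw [seg_op (by omega) (by omega), seg_op (by omega) (by omega), Nat.sub_sub_self (by omega),
          ← op_mul, Nat.sub_self, ← op_mul, h1])
  exact h0.2.2 (.op d') b (by rw [hd, op_mul])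

/-- If two words cut after their first letter yield pairs of `A ×ˢ B`, and one of the two exchanged
pairs is unique but the other one is not, then there is a second unique pair. -/
theorem hasTwoUnique_of_cross {A B : Finset M} (hA : ∀ a ∈ A, ∀ a' ∈ A, len a = len a')
    (hgh : g ≠ h) (hcg : c * x (g * e 0) ∈ A) (hch : c * x (h * e 0) ∈ A)
    (hdg : seg x e g 1 n * d ∈ B) (hdh : seg x e h 1 n * d ∈ B)
    (hu : ¬ UniqueMul A B (c * x (g * e 0)) (seg x e h 1 n * d))
    (hu' : UniqueMul A B (c * x (h * e 0)) (seg x e g 1 n * d)) : HasTwoUnique A B := by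
  have hn := P.n_eq
  have hk := P.two_le
  have hne : c * x (g * e 0) ≠ c * x (h * e 0) := fun h0 => by
    have h1 := S.mul_left_cancel_of h0
    rw [← mul_one (x (g * e 0)), ← mul_one (x (h * e 0))] at h1
    rcases S.head h1 with ⟨h2, -⟩ | ⟨-, m₀, h2, -⟩
    · exact hgh (mul_right_cancel h2)
    · have h3 := congrArg len h2
      rw [S.len_one, S.len_mul, S.len_seg (by omega)] at h3
      omega
  have hne' : seg x e h 1 n * d ≠ seg x e g 1 n * d := fun h0 =>
    hgh (mul_right_cancel (S.suffix_suffix P le_rfl (by omega) le_rfl (by omega) h0).1).symm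
  obtain ⟨p, g', h', j, q, hj, hj', hgh', h1, h2, hA', hB'⟩ :=
    S.exists_cut_of_not_unique P hA hcg hu
  obtain ⟨⟨rfl, rfl⟩ | hjn, ⟨c₀, h3⟩, h4⟩ := S.cut_of_cross P hgh hj hj' h1 h2
  · -- The class of the non-unique pair contains a pair with left factor `p * x (h' * e 0)`.
    rw [seg_single] at h1 hA'
    rw [h2] at hdh hne'
    refine ⟨_, hA', _, hdh, _, hch, _, hdg, .inr hne', ?_, hu'⟩
    by_contra hu2
    obtain ⟨p₂, g₂, h₂, j₂, q₂, hj₂, hj₂', -, h5, h6, -, -⟩ :=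
      S.exists_cut_of_not_unique P hA hA' hu2
    obtain ⟨-, ⟨c₁, h7⟩, h8⟩ := S.cut_of_cross P hgh'.symm hj₂ hj₂' h5 h6
    -- The last letter of `p` is determined by `p * x (g' * e 0) = c * x (g * e 0)`.
    rcases S.last h1 with ⟨h9, -⟩ | ⟨-, m₀, -, h10⟩
    · exact hgh (mul_right_cancel h9)
    · rw [seg_snoc' (by omega), ← mul_assoc] at h10
      have h11 := h8 _ _ h10
      have := P.step_down (i := n - 1 - 1) (by omega) (by omega)
      rw [this, Nat.sub_add_cancel (by omega), ← mul_assoc, inv_mul_cancel_right] at h11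
      exact hgh' (mul_right_cancel (mul_right_cancel h11))
  · obtain rfl : j = n - 1 := by omega
    have hseg : ∀ y, seg x e y (n - 1) n = x (y * e (n - 1)) := fun y => by
      rw [seg_cons (by omega), Nat.sub_add_cancel (by omega), seg_self, mul_one]
    rw [hseg] at h2 hB'
    refine ⟨_, hcg, _, hB', _, hch, _, hdg, .inl hne, ?_, hu'⟩
    by_contra hu2
    obtain ⟨p₂, g₂, h₂, j₂, q₂, hj₂, hj₂', -, h5, h6, -, -⟩ :=
      S.exists_cut_of_not_unique P hA hcg hu2
    rw [h1] at h5
    -- The first letter of `q` is determined by the word with suffix `seg x e h 1 n`.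
    obtain ⟨h7, h8⟩ := S.suffix_head P le_rfl (by omega) h2
    rw [seg_cons (by omega), mul_assoc] at h8
    have h9 := S.head_of_cross P hgh' hj₂ hj₂' h5 h6 h8
    rw [P.step_one, ← mul_assoc, ← h7] at h9
    exact hgh' (mul_right_cancel (mul_right_cancel h9))

/-- Two words cut after their first letter force two unique pairs. -/
theorem hasTwoUnique_of_first {A B : Finset M} (hA : ∀ a ∈ A, ∀ a' ∈ A, len a = len a')
    (hgh : g ≠ h) (hcg : c * x (g * e 0) ∈ A) (hch : c * x (h * e 0) ∈ A)
    (hdg : seg x e g 1 n * d ∈ B) (hdh : seg x e h 1 n * d ∈ B) : HasTwoUnique A B := by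
  have hn := P.n_eq
  have hk := P.two_le
  by_cases hu : UniqueMul A B (c * x (g * e 0)) (seg x e h 1 n * d)
  · by_cases hu' : UniqueMul A B (c * x (h * e 0)) (seg x e g 1 n * d)
    · exact ⟨_, hcg, _, hdh, _, hch, _, hdg, .inr fun h0 => hgh
        (mul_right_cancel (S.suffix_suffix P le_rfl (by omega) le_rfl (by omega) h0).1).symm,
        hu, hu'⟩
    · exact S.hasTwoUnique_of_cross P hA hgh.symm hch hcg hdh hdg hu' hu
  · by_cases hu' : UniqueMul A B (c * x (h * e 0)) (seg x e g 1 n * d)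
    · exact S.hasTwoUnique_of_cross P hA hgh hcg hch hdg hdh hu hu'
    · -- Both exchanged pairs being crossed would give `c` two different last letters.
      obtain ⟨_, _, _, _, _, hj, hj', -, h1, h2, -, -⟩ := S.exists_cut_of_not_unique P hA hcg hu
      obtain ⟨_, _, _, _, _, hi, hi', -, h3, h4, -, -⟩ := S.exists_cut_of_not_unique P hA hch hu'
      obtain ⟨-, ⟨c₀, h5⟩, -⟩ := S.cut_of_cross P hgh hj hj' h1 h2
      obtain ⟨-, -, h6⟩ := S.cut_of_cross P hgh.symm hi hi' h3 h4
      exact absurd (mul_right_cancel (mul_right_cancel (h6 _ _ h5))) hgh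

/-- Two words cut before their last letter force two unique pairs. -/
theorem hasTwoUnique_of_last {A B : Finset M} (hB : ∀ b ∈ B, ∀ b' ∈ B, len b = len b')
    (hgh : g ≠ h) (hcg : c * seg x e g 0 (n - 1) ∈ A) (hch : c * seg x e h 0 (n - 1) ∈ A)
    (hdg : x (g * e (n - 1)) * d ∈ B) (hdh : x (h * e (n - 1)) * d ∈ B) : HasTwoUnique A B := by
  have hn := P.n_eq
  have hk := P.two_le
  have hseg : ∀ y, seg (fun a => MulOpposite.op (x a)) (fun m => e (n - 1 - m)) y 1 n =
      .op (seg x e y 0 (n - 1)) := fun y => by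
    rw [seg_op (by omega) le_rfl, Nat.sub_self]
  refine .of_op ((S.op (by omega)).hasTwoUnique_of_first P.op (g := g) (h := h) (c := .op d)
    (d := .op c) ?_ hgh ?_ ?_ ?_ ?_)
  · simpa using hB
  all_goals simpa [hseg, ← op_mul]

/-- A word system with the ratio profile of a generalized quaternion group has two unique
products. -/
theorem twoUniqueProds : TwoUniqueProds M := by
  have hn := P.n_eq
  have hk := P.two_le
  refine twoUniqueProds_of_homogeneous len S.len_mul fun A B hA hB hcard => ?_
  by_cases hall : ∀ c ∈ A, ∀ d ∈ B, UniqueMul A B c d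
  · rw [← Finset.card_product, Finset.one_lt_card] at hcard
    obtain ⟨⟨c, d⟩, h1, ⟨c', d'⟩, h2, hne⟩ := hcard
    rw [Finset.mem_product] at h1 h2
    refine ⟨c, h1.1, d, h1.2, c', h2.1, d', h2.2, ?_, hall _ h1.1 _ h1.2, hall _ h2.1 _ h2.2⟩
    by_contra! h3
    exact hne (Prod.ext h3.1 h3.2)
  push Not at hall
  obtain ⟨c, hc, d, hd, hu⟩ := hall
  obtain ⟨p, g, h, i, q, hi, hi', hgh, rfl, rfl, hA', hB'⟩ := S.exists_cut_of_not_unique P hA hc hu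
  rcases (show i = 1 ∨ i + 1 = n ∨ (2 ≤ i ∧ i + 2 ≤ n) by omega) with rfl | hin | ⟨hi2, hi3⟩
  · rw [seg_single] at hc hA'
    exact S.hasTwoUnique_of_first P hA hgh hc hA' hd hB'
  · obtain rfl : i = n - 1 := by omega
    have hseg : ∀ y, seg x e y (n - 1) n = x (y * e (n - 1)) := fun y => by
      rw [seg_cons (by omega), Nat.sub_add_cancel (by omega), seg_self, mul_one]
    rw [hseg] at hd hB'
    exact S.hasTwoUnique_of_last P hB hgh hc hA' hd hB'
  · have key : ∀ g h : Γ, g ≠ h → p * seg x e g 0 i ∈ A →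
        UniqueMul A B (p * seg x e g 0 i) (seg x e h i n * q) := fun g h hgh hc => by
      by_contra hu
      obtain ⟨_, _, _, _, _, h1, h2, -, h3, h4, -, -⟩ := S.exists_cut_of_not_unique P hA hc hu
      exact S.not_cut_of_middle P hi2 hi3 hgh h1 h2 h3 h4
    exact ⟨_, hc, _, hB', _, hA', _, hd, .inr fun h0 => hgh (mul_right_cancel
      (S.suffix_suffix P (by omega) hi3 (by omega) (by omega) h0).1).symm,
      key g h hgh hc, key h g hgh.symm hA'⟩

end WordSystem

/-! ### Common multiples in the word congruence -/

section Words
variable {ι α : Type*}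

/-- Replacement, inside a word, of one of the words `W i` by another one. -/
def WordStep (W : ι → List α) (u v : List α) : Prop :=
  ∃ p q i j, u = p ++ W i ++ q ∧ v = p ++ W j ++ q

/-- The congruence on words that identifies all the words `W i`. -/
def WordEq (W : ι → List α) : List α → List α → Prop := ReflTransGen (WordStep W)

variable {W : ι → List α} {u v u' v' : List α}

theorem WordStep.symm (h : WordStep W u v) : WordStep W v u := by
  obtain ⟨p, q, i, j, h1, h2⟩ := h
  exact ⟨p, q, j, i, h2, h1⟩

theorem WordStep.context (h : WordStep W u v) (p q : List α) :
    WordStep W (p ++ u ++ q) (p ++ v ++ q) := by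
  obtain ⟨p', q', i, j, rfl, rfl⟩ := h
  exact ⟨p ++ p', q' ++ q, i, j, by simp, by simp⟩

theorem WordStep.reverse (h : WordStep W u v) :
    WordStep (fun i => (W i).reverse) u.reverse v.reverse := by
  obtain ⟨p, q, i, j, rfl, rfl⟩ := h
  exact ⟨q.reverse, p.reverse, i, j, by simp, by simp⟩

namespace WordEq

theorem refl (u : List α) : WordEq W u u := ReflTransGen.refl

theorem symm (h : WordEq W u v) : WordEq W v u := by
  induction h with
  | refl => exact refl _
  | tail _ hs ih => exact ReflTransGen.head hs.symm ih

theorem trans {w : List α} (h : WordEq W u v) (h' : WordEq W v w) : WordEq W u w :=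
  ReflTransGen.trans h h'

theorem context (h : WordEq W u v) (p q : List α) : WordEq W (p ++ u ++ q) (p ++ v ++ q) := by
  induction h with
  | refl => exact refl _
  | tail _ hs ih => exact ReflTransGen.tail ih (hs.context p q)

theorem append_left (h : WordEq W u v) (p : List α) : WordEq W (p ++ u) (p ++ v) := by
  simpa using h.context p []

theorem append (h : WordEq W u v) (h' : WordEq W u' v') : WordEq W (u ++ u') (v ++ v') := by
  have := h.context [] u'
  simp only [List.nil_append] at this
  exact this.trans (h'.append_left v)

theorem reverse (h : WordEq W u v) : WordEq (fun i => (W i).reverse) u.reverse v.reverse := by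
  induction h with
  | refl => exact refl _
  | tail _ hs ih => exact ReflTransGen.tail ih hs.reverse

theorem length_eq {n : ℕ} (hn : ∀ i, (W i).length = n) (h : WordEq W u v) :
    u.length = v.length := by
  induction h with
  | refl => rfl
  | tail _ hs ih =>
    obtain ⟨p, q, i, j, rfl, rfl⟩ := hs
    simp only [List.length_append, hn] at ih ⊢
    exact ih

/-- If the defining words have the same length and are determined by their first letters, then two
equal words with different first letters are common multiples of the defining words. This includes
left cancellation, which is what makes the induction on the length go through: it identifies the
remaining factors when two such replacements of the first letter are composed. -/
theorem head {n : ℕ} (hn : ∀ i, (W i).length = n) {s : α → List α}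
    (hs : ∀ i, ∃ a, W i = a :: s a) {a b : α} {m m' : List α} (h : WordEq W (a :: m) (b :: m')) :
    (a = b ∧ WordEq W m m') ∨
      (a ≠ b ∧ ∃ m₀, WordEq W m (s a ++ m₀) ∧ WordEq W m' (s b ++ m₀)) := by
  induction hL : m.length using Nat.strong_induction_on generalizing a b m m' with
  | _ L ih =>
    have cancel : ∀ t u v : List α, (t ++ u).length ≤ L → WordEq W (t ++ u) (t ++ v) →
        WordEq W u v := by
      intro t
      induction t with
      | nil => exact fun u v _ h => h
      | cons y t iht =>
        intro u v hl h
        simp only [List.cons_append, List.length_cons] at hl h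
        rcases ih _ (by omega) h rfl with ⟨-, h⟩ | ⟨h, -⟩
        · exact iht u v (by omega) h
        · exact absurd rfl h
    suffices H : ∀ w, WordEq W (a :: m) w → ∃ b m', w = b :: m' ∧ ((a = b ∧ WordEq W m m') ∨
        (a ≠ b ∧ ∃ m₀, WordEq W m (s a ++ m₀) ∧ WordEq W m' (s b ++ m₀))) by
      obtain ⟨b', m'', h1, h2⟩ := H _ h
      obtain ⟨rfl, rfl⟩ := List.cons_eq_cons.1 h1
      exact h2
    intro w hw
    induction hw with
    | refl => exact ⟨a, m, rfl, .inl ⟨rfl, refl m⟩⟩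
    | @tail v w hv hstep ihw =>
      obtain ⟨b, m', rfl, hb⟩ := ihw
      have hlen : m'.length = L := by
        have := length_eq hn hv
        simp only [List.length_cons] at this
        omega
      obtain ⟨p, q, i, j, h1, rfl⟩ := hstep
      rcases p with _ | ⟨y, p⟩
      · obtain ⟨c, hc⟩ := hs i
        obtain ⟨d, hd⟩ := hs j
        simp only [List.nil_append, hc, List.cons_append, List.cons_eq_cons] at h1
        obtain ⟨rfl, rfl⟩ := h1
        refine ⟨d, s d ++ q, by simp [hd], ?_⟩
        rcases hb with ⟨rfl, hb⟩ | ⟨hne, m₀, h2, h3⟩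
        · by_cases had : a = d
          · subst had
            exact .inl ⟨rfl, hb⟩
          · exact .inr ⟨had, q, hb, refl _⟩
        · have h4 := cancel _ _ _ hlen.le h3
          by_cases had : a = d
          · subst had
            exact .inl ⟨rfl, h2.trans (h4.symm.append_left _)⟩
          · exact .inr ⟨had, m₀, h2, h4.append_left _⟩
      · simp only [List.cons_append, List.cons_eq_cons] at h1
        obtain ⟨rfl, rfl⟩ := h1
        have hst : WordEq W (p ++ W i ++ q) (p ++ W j ++ q) :=
          ReflTransGen.single ⟨p, q, i, j, rfl, rfl⟩
        refine ⟨b, p ++ W j ++ q, by simp, ?_⟩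
        rcases hb with ⟨rfl, hb⟩ | ⟨hne, m₀, h2, h3⟩
        · exact .inl ⟨rfl, hb.trans hst⟩
        · exact .inr ⟨hne, m₀, h2, hst.symm.trans h3⟩

end WordEq
end Words

/-! ### Word systems from presentations -/

section Presentation
variable {Γ M : Type*} [Group Γ] [Monoid M]

/-- The letters in positions `i, …, j - 1` of the word `w_g`, as a list. -/
def wordSeg (e : ℕ → Γ) (g : Γ) (i j : ℕ) : List Γ := (List.range' i (j - i)).map fun m => g * e m

variable {x : Γ → M} {e : ℕ → Γ} {n : ℕ}

theorem prod_wordSeg (g : Γ) (i j : ℕ) : ((wordSeg e g i j).map x).prod = seg x e g i j := by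
  rw [wordSeg, List.map_map]
  rfl

theorem wordSeg_cons (hn : 1 ≤ n) (g : Γ) : wordSeg e g 0 n = g * e 0 :: wordSeg e g 1 n := by
  obtain ⟨n, rfl⟩ := Nat.exists_eq_add_of_le' hn
  simp [wordSeg, List.range'_succ]

theorem wordSeg_snoc (hn : 1 ≤ n) (g : Γ) :
    wordSeg e g 0 n = wordSeg e g 0 (n - 1) ++ [g * e (n - 1)] := by
  obtain ⟨n, rfl⟩ := Nat.exists_eq_add_of_le' hn
  simp [wordSeg, List.range'_concat]

/-- A monoid presented by the letters `x a` and the relations `w_g = w_h` is a word system. -/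
theorem exists_wordSystem (hn : 1 ≤ n) (hx : ∀ m, ∃ l : List Γ, (l.map x).prod = m)
    (hker : ∀ u v : List Γ, (u.map x).prod = (v.map x).prod ↔
      WordEq (fun g => wordSeg e g 0 n) u v) :
    ∃ len, WordSystem x e n len := by
  choose f hf using hx
  have hlen : ∀ g, (wordSeg e g 0 n).length = n := fun g => by simp [wordSeg]
  have hL : ∀ u : List Γ, (f ((u.map x).prod)).length = u.length := fun u =>
    WordEq.length_eq hlen ((hker _ _).1 (hf _))
  refine ⟨fun m => (f m).length, ⟨fun a b => ?_, fun a => ?_, fun m => ?_, fun m => ?_,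
    fun g h => ?_, fun {a b m m'} hab => ?_, fun {a b m m'} hab => ?_⟩⟩
  · obtain ⟨u, rfl⟩ : ∃ u : List Γ, (u.map x).prod = a := ⟨f a, hf a⟩
    obtain ⟨v, rfl⟩ : ∃ v : List Γ, (v.map x).prod = b := ⟨f b, hf b⟩
    rw [← List.prod_append, ← List.map_append, hL, hL, hL, List.length_append]
  · simpa using hL [a]
  · rw [← hf m]
    rcases f m with _ | ⟨a, l⟩
    · exact .inl (by simp)
    · exact .inr ⟨a, (l.map x).prod, by simp⟩
  · rw [← hf m]
    rcases List.eq_nil_or_concat (f m) with h | ⟨l, a, h⟩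
    · exact .inl (by simp [h])
    · exact .inr ⟨a, (l.map x).prod, by simp [h]⟩
  · rw [← prod_wordSeg, ← prod_wordSeg, hker]
    exact ReflTransGen.single ⟨[], [], g, h, by simp, by simp⟩
  · have h0 : WordEq (fun g => wordSeg e g 0 n) (a :: f m) (b :: f m') := by
      rw [← hker]
      simpa [hf] using hab
    rcases WordEq.head hlen (s := fun a => wordSeg e (a * (e 0)⁻¹) 1 n)
      (fun g => ⟨g * e 0, by simpa using wordSeg_cons hn g⟩) h0 with ⟨h1, h2⟩ | ⟨h1, m₀, h2, h3⟩
    · exact .inl ⟨h1, by rw [← hf m, ← hf m', hker]; exact h2⟩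
    · refine .inr ⟨h1, (m₀.map x).prod, ?_, ?_⟩
      · rw [← prod_wordSeg, ← List.prod_append, ← List.map_append, ← hf m, hker]
        exact h2
      · rw [← prod_wordSeg, ← List.prod_append, ← List.map_append, ← hf m', hker]
        exact h3
  · have h0 : WordEq (fun g => wordSeg e g 0 n) (f m ++ [a]) (f m' ++ [b]) := by
      rw [← hker]
      simpa [hf] using hab
    have h0' := h0.reverse
    simp only [List.reverse_append, List.reverse_singleton, List.singleton_append] at h0'
    have back : ∀ {u v : List Γ},
        WordEq (fun g => (wordSeg e g 0 n).reverse) u.reverse v.reverse →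
        WordEq (fun g => wordSeg e g 0 n) u v := fun h => by
      simpa using h.reverse
    rcases WordEq.head (n := n) (fun g => by rw [List.length_reverse, hlen])
      (s := fun a => (wordSeg e (a * (e (n - 1))⁻¹) 0 (n - 1)).reverse)
      (fun g => ⟨g * e (n - 1), by simp [wordSeg_snoc hn g]⟩) h0' with
      ⟨h1, h2⟩ | ⟨h1, m₀, h2, h3⟩
    · exact .inl ⟨h1, by rw [← hf m, ← hf m', hker]; exact back h2⟩
    · refine .inr ⟨h1, (m₀.reverse.map x).prod, ?_, ?_⟩
      · rw [← prod_wordSeg, ← List.prod_append, ← List.map_append, ← hf m, hker]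
        exact back (by simpa using h2)
      · rw [← prod_wordSeg, ← List.prod_append, ← List.map_append, ← hf m', hker]
        exact back (by simpa using h3)

end Presentation

/-! ### The generalized quaternion group -/

namespace QuaternionGroup
variable (k : ℕ)

/-- The enumeration `enum`, extended by `1` beyond the `4 * k` positions. -/
def enumNat (i : ℕ) : QuaternionGroup k := if h : i < 4 * k then enum k ⟨i, h⟩ else 1

theorem enumNat_of_lt {i : ℕ} (hi : i < 2 * k) : enumNat k i = a (i : ZMod (2 * k)) := by
  rw [enumNat, dif_pos (by omega), enum, if_pos hi, t, a_one_pow]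

theorem enumNat_add {i : ℕ} (hi : i < 2 * k) :
    enumNat k (2 * k + i) = xa (-(i : ZMod (2 * k))) := by
  rw [enumNat, dif_pos (by omega), enum, if_neg (by simp)]
  simp [t, u]

theorem inv_t : (t k)⁻¹ = a (-1) := rfl

theorem ratioProfile (hk : 2 ≤ k) :
    RatioProfile (enumNat k) (4 * k) k (t k) (t k * u k) where
  n_eq := rfl
  two_le := hk
  ne_inv h := by
    have h1 : (1 : ZMod (2 * k)) = -1 := by
      rw [inv_t] at h
      simpa [t] using h
    have h2 : ((2 : ℕ) : ZMod (2 * k)) = 0 := by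
      push_cast
      linear_combination h1
    have := Nat.le_of_dvd (by norm_num) ((ZMod.natCast_eq_zero_iff _ _).1 h2)
    omega
  ne_left h := by simp [t, u] at h
  ne_right h := by
    rw [inv_t] at h
    simp [t, u] at h
  step i hi := by
    rcases lt_or_ge (i + 1) (2 * k) with h1 | h1
    · rw [ratio, if_pos h1, enumNat_of_lt k h1, enumNat_of_lt k (by omega)]
      simp [t]
    rcases h1.eq_or_lt with h1 | h1
    · have h2 := enumNat_add k (i := 0) (by omega)
      have h3 : ((i : ZMod (2 * k))) + 1 = 0 := by
        rw [← Nat.cast_one, ← Nat.cast_add, ← h1, ZMod.natCast_self]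
      rw [add_zero] at h2
      rw [ratio, if_neg (by omega), if_pos h1.symm, ← h1, h2, enumNat_of_lt k (by omega)]
      simp [t, u]
      linear_combination h3
    · obtain ⟨j, rfl⟩ : ∃ j, i = 2 * k + j := ⟨i - 2 * k, by omega⟩
      rw [ratio, if_neg (by omega), if_neg (by omega), add_assoc, enumNat_add k (by omega),
        enumNat_add k (by omega)]
      simp [inv_t]
      ring

variable [NeZero k]

theorem cayleyRep_apply (g : QuaternionGroup k) (i : Fin (4 * k)) :
    cayleyRep k g i = positions k (g * enum k i) := rfl

theorem map_permWord (g : QuaternionGroup k) :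
    (FreeMonoid.toList (permWord (cayleyRep k g))).map (positions k).symm =
      wordSeg (enumNat k) g 0 (4 * k) := by
  refine List.ext_getElem (by simp [permWord, wordSeg]) fun i h1 h2 => ?_
  have h3 : i < 4 * k := by simpa [wordSeg] using h2
  simp [permWord, wordSeg, cayleyRep_apply, enumNat, h3]

theorem exists_wordSystem_permMonoid (hk : 1 ≤ k) :
    ∃ len, WordSystem (fun g => PresentedMonoid.of (permRel (cayleyRep k).range) (positions k g))
      (enumNat k) (4 * k) len := by
  have hprod : ∀ l : List (QuaternionGroup k), (l.map fun g =>
      PresentedMonoid.of (permRel (cayleyRep k).range) (positions k g)).prod =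
        PresentedMonoid.mk _ (FreeMonoid.ofList (l.map (positions k))) := by
    intro l
    induction l with
    | nil => rfl
    | cons g l ih =>
      rw [List.map_cons, List.prod_cons, ih, List.map_cons, FreeMonoid.ofList_cons, map_mul]
      rfl
  refine exists_wordSystem (by omega) (fun m => ?_) (fun u v => ?_)
  · obtain ⟨w, rfl⟩ := PresentedMonoid.surjective_mk m
    exact ⟨w.toList.map (positions k).symm, by rw [hprod]; simp⟩
  · rw [hprod, hprod, PresentedMonoid.mk_eq_mk_iff]
    constructor
    · have key : ∀ a b : FreeMonoid (Fin (4 * k)),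
          ConGen.Rel (permRel (cayleyRep k).range) a b →
          WordEq (fun g => wordSeg (enumNat k) g 0 (4 * k))
            (a.toList.map (positions k).symm) (b.toList.map (positions k).symm) := by
        intro a b hab
        induction hab with
        | of a b hab =>
          obtain ⟨σ, ⟨g, rfl⟩, rfl, rfl⟩ := hab
          rw [← map_one (cayleyRep k), map_permWord, map_permWord]
          exact ReflTransGen.single ⟨[], [], 1, g, by simp, by simp⟩
        | refl a => exact .refl _
        | symm _ ih => exact ih.symm
        | trans _ _ ih ih' => exact ih.trans ih'
        | mul _ _ ih ih' =>
          rw [FreeMonoid.toList_mul, FreeMonoid.toList_mul, List.map_append, List.map_append]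
          exact ih.append ih'
      intro h
      simpa using key _ _ h
    · intro h
      induction h with
      | refl => exact Con.refl _ _
      | tail _ hs ih =>
        refine Con.trans _ ih ?_
        obtain ⟨p, q, g, h, rfl, rfl⟩ := hs
        have hg : ∀ g, conGen (permRel (cayleyRep k).range) (permWord 1)
            (FreeMonoid.ofList ((wordSeg (enumNat k) g 0 (4 * k)).map (positions k))) := by
          intro g
          rw [← map_permWord]
          refine .of _ _ ⟨cayleyRep k g, ⟨g, rfl⟩, rfl, ?_⟩
          simp
        simp only [List.map_append, FreeMonoid.ofList_append]
        exact Con.mul _ (Con.mul _ (Con.refl _ _) (Con.trans _ (Con.symm _ (hg g)) (hg h)))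
          (Con.refl _ _)

end QuaternionGroup

/-- With `H` the regular representation of the generalized quaternion group of order
`n = 4 * k ≥ 8`, the monoid `S_n(H)` is a two unique product semigroup. -/
theorem theorem3p1 (k : ℕ) [NeZero k] (hk : 2 ≤ k) :
    TwoUniqueProds (PermMonoid (QuaternionGroup.cayleyRep k).range) := by
  obtain ⟨len, S⟩ := QuaternionGroup.exists_wordSystem_permMonoid k (by omega)
  exact S.twoUniqueProds (QuaternionGroup.ratioProfile k hk)
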